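/- Let $\mathrm{Inv}\langle A\mid R\rangle$ be a finite presentation of an inverse monoid: $A$ is a finite set, $\widetilde A=A\cup A^{-1}$, $R$ is a finite subset of $\widetilde A^*\times\widetilde A^*$, and $$M=\widetilde A^*/(\rho_A\cup R)^{\sharp},$$ where $\rho_A$ is the congruence on $\widetilde A^*$ generated by all pairs $(ww^{-1}w,w)$ and $(uu^{-1}vv^{-1},vv^{-1}uu^{-1})$ with $u,v,w\in\widetilde A^*$, and $X^\sharp$ denotes the congruence generated by $X$. Fix a letter $a_i\in A$, put $A_i=A\setminus\{a_i\}$, let $\theta_i:\widetilde A^*\to\widetilde{A_i}^*$ be the homomorphism that erases all occurrences of $a_i$ and $a_i^{-1}$, and let $$M_i=\widetilde{A_i}^*/(\rho_{A_i}\cup\{(r\theta_i,s\theta_i):(r,s)\in R\})^{\sharp}.$$ Let $\varepsilon_i:M\to M_i$ be the homomorphism sending the class of a word $w$ to the class of $w\theta_i$. For elements of an inverse monoid write $u\,\mathcal R\,v$ if $uu^{-1}=vv^{-1}$, and $u\le v$ if $u=ev$ for some idempotent $e$; an inverse monoid has finite $\mathcal R$-classes if each of its $\mathcal R$-classes is a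 finite set. **Proposition.** Suppose that $M$ has finite $\mathcal R$-classes and that for every idempotent $e$ of $M_i$ the preimage $\varepsilon_i^{-1}(e)=\{g\in M:\varepsilon_i(g)=e\}$ has a minimum idempotent, i.e. it contains an idempotent $f$ such that $f\le g$ for every idempotent $g\in\varepsilon_i^{-1}(e)$. Then $M_i$ also has finite $\mathcal R$-classes. -/

import Mathlib

/-- An inverse monoid: a monoid in which every element `x` has exactly one inverse `x⁻¹`,
in the sense that `x * x⁻¹ * x = x` and `x⁻¹ * x * x⁻¹ = x⁻¹`. -/
class InverseMonoid (M : Type*) extends Monoid M, Inv M where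
  mul_inv_mul : ∀ x : M, x * x⁻¹ * x = x
  inv_mul_inv : ∀ x : M, x⁻¹ * x * x⁻¹ = x⁻¹
  inv_unique : ∀ x y : M, x * y * x = x → y * x * y = y → y = x⁻¹

namespace InverseMonoid

variable {M : Type*} [InverseMonoid M]

/-- Green's relation `𝓡` on an inverse monoid: `u 𝓡 v` iff `u u⁻¹ = v v⁻¹`. -/
def GreenR (u v : M) : Prop := u * u⁻¹ = v * v⁻¹

/-- The natural partial order on an inverse monoid: `u ≤ v` iff `u = e v` for some
idempotent `e`. -/
def NatLE (u v : M) : Prop := ∃ e : M, IsIdempotentElem e ∧ u = e * v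

/-- `f` is a minimum idempotent of `S`: it is an idempotent of `S` lying below every
idempotent of `S` in the natural partial order. -/
def IsMinimumIdempotent (S : Set M) (f : M) : Prop :=
  f ∈ S ∧ IsIdempotentElem f ∧ ∀ g ∈ S, IsIdempotentElem g → NatLE f g

variable (M) in
/-- `M` has finite `𝓡`-classes: the `𝓡`-class of every element is finite. -/
def HasFiniteRClasses : Prop := ∀ u : M, {v : M | GreenR v u}.Finite

end InverseMonoid

namespace InvPres

/-- Words over `A ∪ A⁻¹`; the letter `(a, true)` is `a` and `(a, false)` is `a⁻¹`. -/
abbrev Word (A : Type*) := FreeMonoid (A × Bool)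

/-- The involution on words: reverse the word and invert each letter. -/
def Word.inv {A : Type*} (w : Word A) : Word A :=
  FreeMonoid.ofList ((w.toList.map fun x => (x.1, !x.2)).reverse)

theorem Word.inv_one {A : Type*} : Word.inv (1 : Word A) = 1 := rfl

theorem Word.inv_of {A : Type*} (x : A × Bool) :
    Word.inv (FreeMonoid.of x) = FreeMonoid.of (x.1, !x.2) := rfl

theorem Word.inv_mul {A : Type*} (u v : Word A) :
    Word.inv (u * v) = Word.inv v * Word.inv u := by
  simp [Word.inv, FreeMonoid.toList_mul, FreeMonoid.ofList_append]

theorem Word.inv_inv {A : Type*} (w : Word A) : Word.inv (Word.inv w) = w := by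
  simp [Word.inv, List.map_reverse, Function.comp_def]

/-- The pairs generating the Vagner congruence. -/
inductive VagnerRel {A : Type*} : Word A → Word A → Prop
  | regular (w : Word A) : VagnerRel (w * w.inv * w) w
  | comm (u v : Word A) : VagnerRel (u * u.inv * (v * v.inv)) (v * v.inv * (u * u.inv))

/-- The congruence `(ρ_A ∪ R)^♯` on words. -/
def presCon {A : Type*} (R : Set (Word A × Word A)) : Con (Word A) :=
  conGen fun u v => VagnerRel u v ∨ (u, v) ∈ R

/-- The inverse monoid `Inv⟨A | R⟩`. -/
abbrev InvMon {A : Type*} (R : Set (Word A × Word A)) : Type _ := (presCon R).Quotient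

section Inverse

variable {A : Type*} {R : Set (Word A × Word A)}

theorem mk_regular (w : Word A) : (w : InvMon R) * (w.inv : Word A) * w = w :=
  (Con.eq (presCon R)).2 (ConGen.Rel.of _ _ (Or.inl (VagnerRel.regular w)))

theorem mk_regular' (w : Word A) :
    ((w.inv : Word A) : InvMon R) * w * (w.inv : Word A) = (w.inv : Word A) := by
  have h := mk_regular (R := R) w.inv
  rwa [Word.inv_inv] at h

theorem mk_comm (u v : Word A) :
    (u : InvMon R) * (u.inv : Word A) * ((v : InvMon R) * (v.inv : Word A)) =
      (v : InvMon R) * (v.inv : Word A) * ((u : InvMon R) * (u.inv : Word A)) :=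
  (Con.eq (presCon R)).2 (ConGen.Rel.of _ _ (Or.inl (VagnerRel.comm u v)))

theorem mk_comm' (u v : Word A) :
    ((u.inv : Word A) : InvMon R) * u * (((v.inv : Word A) : InvMon R) * v) =
      ((v.inv : Word A) : InvMon R) * v * (((u.inv : Word A) : InvMon R) * u) := by
  have h := mk_comm (R := R) u.inv v.inv
  rwa [Word.inv_inv, Word.inv_inv] at h

theorem idem_eq {w : Word A} (h : (w : InvMon R) * w = w) :
    (w : InvMon R) = (w.inv : Word A) := by
  have h1 := mk_regular (R := R) w
  have h2 := mk_regular' (R := R) w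
  have h3 := mk_comm (R := R) w w.inv
  rw [Word.inv_inv] at h3
  generalize (w : InvMon R) = e at *
  generalize ((w.inv : Word A) : InvMon R) = f at *
  have hff : f * f = f := by
    have hf : f = f * e * (e * f) := by
      calc f = f * e * f := h2.symm
        _ = f * (e * e) * f := by rw [h]
        _ = _ := by simp only [mul_assoc]
    have hf' : f = e * f * (f * e) := hf.trans h3.symm
    have hp : f * e * (f * e) = f * e := by rw [← mul_assoc, h2]
    have hq : e * f * (e * f) = e * f := by rw [← mul_assoc, h1]
    calc f * f = e * f * (f * e) * (f * e * (e * f)) := by rw [← hf, ← hf']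
      _ = e * f * (f * e * (f * e)) * (e * f) := by simp only [mul_assoc]
      _ = f * e * (e * f * (e * f)) := by rw [hp, h3]; simp only [mul_assoc]
      _ = f := by rw [hq, ← hf]
  calc e = e * f * e := h1.symm
    _ = e * (f * f) * e := by rw [hff]
    _ = e * f * (f * e) := by simp only [mul_assoc]
    _ = f * e * (e * f) := h3
    _ = f * (e * e) * f := by simp only [mul_assoc]
    _ = f := by rw [h, h2]

theorem inverse_unique (x y z : InvMon R) (hzx : z * x * z = z) (hxz : x * z * x = x)
    (hzy : z * y * z = z) (hyz : y * z * y = y) : x = y := by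
  have idem : ∀ p : InvMon R, p * p = p → ∃ w : Word A, p = (w : InvMon R) * (w.inv : Word A) := by
    intro p
    induction p using Con.induction_on with
    | _ w => intro hp; exact ⟨w, by rw [← idem_eq hp, hp]⟩
  have comm : ∀ p q : InvMon R, p * p = p → q * q = q → p * q = q * p := by
    intro p q hp hq
    obtain ⟨u, rfl⟩ := idem p hp
    obtain ⟨v, rfl⟩ := idem q hq
    exact mk_comm u v
  have i1 : z * x * (z * x) = z * x := by rw [← mul_assoc, hzx]
  have i2 : z * y * (z * y) = z * y := by rw [← mul_assoc, hzy]
  have i3 : x * z * (x * z) = x * z := by rw [← mul_assoc, hxz]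
  have i4 : y * z * (y * z) = y * z := by rw [← mul_assoc, hyz]
  calc x = x * (z * y * z) * x := by rw [hzy, hxz]
    _ = x * (z * y * (z * x)) := by simp only [mul_assoc]
    _ = x * (z * x * (z * y)) := by rw [comm _ _ i2 i1]
    _ = x * z * x * z * y := by simp only [mul_assoc]
    _ = x * z * (y * z * y) := by rw [hxz, hyz]
    _ = x * z * (y * z) * y := by simp only [mul_assoc]
    _ = y * z * (x * z) * y := by rw [comm _ _ i3 i4]
    _ = y * (z * x * z) * y := by simp only [mul_assoc]
    _ = y := by rw [hzx, hyz]

theorem inv_congr {u v : Word A} (h : presCon R u v) : presCon R u.inv v.inv := by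
  refine (Con.eq (presCon R)).1 ?_
  have huv : (u : InvMon R) = v := (Con.eq (presCon R)).2 h
  refine inverse_unique _ _ (u : InvMon R) (mk_regular u) (mk_regular' u) ?_ ?_
  · rw [huv]; exact mk_regular v
  · rw [huv]; exact mk_regular' v

/-- `Inv⟨A | R⟩` is an inverse monoid, the inverse of the class of `w` being the class of the
formal inverse of `w`. -/
instance instInverseMonoid : InverseMonoid (InvMon R) where
  toMonoid := inferInstance
  inv x := Con.liftOn x (fun w => ((w.inv : Word A) : InvMon R))
    fun _ _ h => (Con.eq (presCon R)).2 (inv_congr h)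
  mul_inv_mul x := by
    induction x using Con.induction_on with
    | _ w => exact mk_regular w
  inv_mul_inv x := by
    induction x using Con.induction_on with
    | _ w => exact mk_regular' w
  inv_unique x y h1 h2 := by
    induction x using Con.induction_on with
    | _ w => exact inverse_unique _ _ _ h1 h2 (mk_regular w) (mk_regular' w)

end Inverse

/-- The alphabet `A` with the letter `a` removed. -/
abbrev Rest {A : Type*} (a : A) : Type _ := {b : A // b ≠ a}

open Classical in
/-- The homomorphism `θ` erasing all occurrences of `a` and `a⁻¹` from a word. -/
noncomputable def erase {A : Type*} (a : A) : Word A →* Word (Rest a) :=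
  FreeMonoid.lift fun x => if h : x.1 = a then 1 else FreeMonoid.of (⟨x.1, h⟩, x.2)

/-- The relations obtained from `R` by erasing the letter `a` in both sides. -/
def eraseRel {A : Type*} (a : A) (R : Set (Word A × Word A)) :
    Set (Word (Rest a) × Word (Rest a)) :=
  (fun p => (erase a p.1, erase a p.2)) '' R

theorem erase_inv {A : Type*} (a : A) (w : Word A) : erase a w.inv = (erase a w).inv := by
  induction w using FreeMonoid.inductionOn' with
  | one => simp [Word.inv_one]
  | of_mul x w ih =>
    rw [Word.inv_mul, map_mul, map_mul, Word.inv_mul, ih, Word.inv_of]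
    congr 1
    by_cases h : x.1 = a <;> simp [erase, h, Word.inv_one, Word.inv_of]

/-- The component `M_i` of `Inv⟨A | R⟩` for the letter `a = a_i`, namely the inverse monoid
presented by the remaining letters and the erased relations. -/
abbrev Component {A : Type*} (a : A) (R : Set (Word A × Word A)) : Type _ :=
  InvMon (eraseRel a R)

theorem presCon_le_ker {A : Type*} (a : A) (R : Set (Word A × Word A)) :
    presCon R ≤ Con.ker ((presCon (eraseRel a R)).mk'.comp (erase a)) := by
  refine Con.conGen_le.2 ?_
  rintro u v (h | h)
  · refine (Con.eq (presCon (eraseRel a R))).2 ?_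
    cases h with
    | regular w =>
      simp only [map_mul, erase_inv]
      exact ConGen.Rel.of _ _ (Or.inl (VagnerRel.regular _))
    | comm u v =>
      simp only [map_mul, erase_inv]
      exact ConGen.Rel.of _ _ (Or.inl (VagnerRel.comm _ _))
  · exact (Con.eq (presCon (eraseRel a R))).2
      (ConGen.Rel.of _ _ (Or.inr ⟨(u, v), h, rfl⟩))

/-- The eraser morphism `ε_i : M → M_i` for `a = a_i`, sending the class of a word `w` to the
class of the word obtained from `w` by erasing `a` and `a⁻¹`. -/
noncomputable def eraser {A : Type*} (a : A) (R : Set (Word A × Word A)) :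
    InvMon R →* Component a R :=
  (presCon R).lift ((presCon (eraseRel a R)).mk'.comp (erase a)) (presCon_le_ker a R)

end InvPres

namespace InvPres

variable {A : Type*} {R : Set (Word A × Word A)}

/-! Each `𝓡`-class of the component is covered by the image of a single `𝓡`-class of `M`. Given `u`,
let `f` be the minimum idempotent over `u u⁻¹`. If `v 𝓡 u`, lift `v` to some `g` in `M`
(`eraser_surjective`). Since the eraser preserves inverses (`eraser_inv`), `g g⁻¹` is an idempotent
over `v v⁻¹ = u u⁻¹`, so `f ≤ g g⁻¹`. Hence `f g 𝓡 f` (`greenR_mul_of_natLE`), while `f g` maps to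
`v v⁻¹ v = v`. The choice of `f` depends only on `u u⁻¹`, so finiteness of its `𝓡`-class bounds that
of `u`. -/

theorem mul_inv_rev (x y : InvMon R) : (x * y)⁻¹ = y⁻¹ * x⁻¹ := by
  induction x using Con.induction_on with
  | _ u =>
    induction y using Con.induction_on with
    | _ v => exact congrArg (fun w : Word A => (w : InvMon R)) (Word.inv_mul u v)

theorem isIdempotentElem_mul_inv (x : InvMon R) : IsIdempotentElem (x * x⁻¹) := by
  rw [IsIdempotentElem, ← mul_assoc, InverseMonoid.mul_inv_mul]

/-- Inverses on both sides are classes of formal inverses of words, so the claim reduces to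
`erase_inv` on a representative. -/
theorem eraser_inv (a : A) (x : InvMon R) : eraser a R x⁻¹ = (eraser a R x)⁻¹ := by
  induction x using Con.induction_on with
  | _ w => exact congrArg (fun w : Word (Rest a) => (w : Component a R)) (erase_inv a w)

theorem erase_surjective (a : A) : Function.Surjective (erase a) := by
  intro w
  induction w using FreeMonoid.inductionOn' with
  | one => exact ⟨1, map_one _⟩
  | of_mul x w ih =>
    obtain ⟨v, rfl⟩ := ih
    -- A letter of `Rest a` is a letter of `A` other than `a`, so erasing leaves it in place.
    exact ⟨FreeMonoid.of (x.1.1, x.2) * v, by simp [erase, x.1.2]⟩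

theorem eraser_surjective (a : A) (R : Set (Word A × Word A)) :
    Function.Surjective (eraser a R) := by
  intro y
  induction y using Con.induction_on with
  | _ w =>
    obtain ⟨v, rfl⟩ := erase_surjective a w
    exact ⟨(v : InvMon R), rfl⟩

/-- If `f` is below `g g⁻¹`, then `f g` lies in the `𝓡`-class of `f`. -/
theorem greenR_mul_of_natLE {f g : InvMon R}
    (h : InverseMonoid.NatLE f (g * g⁻¹)) : InverseMonoid.GreenR (f * g) f := by
  obtain ⟨e, -, he⟩ := h
  -- Being `e (g g⁻¹)` with `g g⁻¹` idempotent, `f` absorbs `g g⁻¹` on the right.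
  have hfg : f * (g * g⁻¹) = f := by
    rw [he, mul_assoc, (isIdempotentElem_mul_inv g).eq]
  calc f * g * (f * g)⁻¹ = f * (g * g⁻¹) * f⁻¹ := by simp only [mul_inv_rev, mul_assoc]
    _ = f * f⁻¹ := by rw [hfg]

end InvPres

theorem proposition4p16 {A : Type*} [Finite A]
    (R : Set (InvPres.Word A × InvPres.Word A)) (hR : R.Finite) (a : A)
    (hM : InverseMonoid.HasFiniteRClasses (InvPres.InvMon R))
    (hmin : ∀ e : InvPres.Component a R, IsIdempotentElem e →
      ∃ f : InvPres.InvMon R,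
        InverseMonoid.IsMinimumIdempotent {g : InvPres.InvMon R | InvPres.eraser a R g = e} f) :
    InverseMonoid.HasFiniteRClasses (InvPres.Component a R) := by
  intro u
  obtain ⟨f, hfe, hf, hle⟩ := hmin (u * u⁻¹) (InvPres.isIdempotentElem_mul_inv u)
  refine ((hM f).image (InvPres.eraser a R)).subset fun v (hv : v * v⁻¹ = u * u⁻¹) => ?_
  obtain ⟨g, rfl⟩ := InvPres.eraser_surjective a R v
  -- The lift `g` may lie in any `𝓡`-class of `M`; cutting it down by `f` moves it into that of `f`
  -- without changing its image.
  refine ⟨f * g, InvPres.greenR_mul_of_natLE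
    (hle _ ?_ (InvPres.isIdempotentElem_mul_inv g)), ?_⟩
  · change InvPres.eraser a R (g * g⁻¹) = u * u⁻¹
    rw [map_mul, InvPres.eraser_inv, hv]
  · rw [map_mul, show InvPres.eraser a R f = u * u⁻¹ from hfe, ← hv, InverseMonoid.mul_inv_mul]
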